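/- All graphs are finite and simple and all logarithms are to base $2$. For integers $t,m$ let $R(t,m)$ be the least $n$ such that every graph on $n$ vertices contains a clique $K_t$ or an independent set of size $m$, and for $t\ge 2$ let $Q(t,n)$ be the minimum independence number of a $K_t$-free graph on $n$ vertices. For a graph $H$ and real $x$ let $RT(n,H,x)$ be the maximum number of edges of an $H$-free graph on $n$ vertices with independence number less than $x$ (and $0$ if there is no such graph). For $f:\mathbb N\to\mathbb R$ put $$\overline{RT}(H,f)=\limsup_{n\to\infty}\frac{RT(n,H,f(n))}{n^2},\qquad \underline{RT}(H,f)=\liminf_{n\to\infty}\frac{RT(n,H,f(n))}{n^2}.$$ We say that $H$ has a phase transition from $f$ to $g$ if $\overline{RT}(H,g)<\underline{RT}(H,f)$. (The notion is meant for $g\le f$, but this is not required, so "no phase transition" always means $\overline{RT}(H,g)\ge\underline{RT}(H,f)$.) For $\varphi(n)\to0$, $H$ has a $\varphi$-phase-transition at $f$ if it has a phase transition from $f$ to $\varphi f$. $H$ has a weak phase transition at $f$ if for some $\varepsilon>0$ it has a $\varphi$-phase-transition at $f$ with $\varphi(n)=2^{-(\log n)^{1-\varepsilon}}$, where in particular $\varphi(n)\to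 0$. **Theorem.** Let $s\ge 0$ and $t\ge 2$ be integers. Assume that there exist $\vartheta>0$ and $N>0$ such that $$R(t,n)\le \frac{R(t+1,n)}{n^{\vartheta}}\qquad\text{for all } n>N,$$ and that $K_s$ has a phase transition from $Q(t,n)$ to $Q(t+1,n)$. Then there exists $\varepsilon\in(0,1)$ such that for every function $\omega(n)\to\infty$, with $\varphi_\varepsilon(n)=2^{-\omega(n)(\log n)^{1-\varepsilon}}$, the graph $K_s$ has a $\varphi_\varepsilon$-phase-transition at $Q(t,n)$, and $K_s$ has no phase transition from $\varphi_\varepsilon(n)\,Q(t,n)$ to $Q(t+1,n)$. Moreover, $K_s$ has a weak phase transition at $Q(t,n)$. -/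

import Mathlib

open Filter Topology

/-- The Ramsey number `R(t, m)`: the least `n` such that every graph on `n` vertices contains a
clique on `t` vertices or an independent set of size `m`. -/
noncomputable def ramseyR (t m : ℕ) : ℕ :=
  sInf {n : ℕ | ∀ G : SimpleGraph (Fin n),
    (∃ S : Finset (Fin n), G.IsNClique t S) ∨ (∃ S : Finset (Fin n), G.IsNIndepSet m S)}

/-- The inverse Ramsey function `Q(t, n)`: the least independence number of a `K_t`-free graph on
`n` vertices. For `t ≥ 2` such graphs exist for every `n`. -/
noncomputable def ramseyQ (t n : ℕ) : ℕ :=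
  sInf {a : ℕ | ∃ G : SimpleGraph (Fin n), G.CliqueFree t ∧ G.indepNum = a}

/-- The polynomial gap between consecutive Ramsey numbers at `l` (meant for `l ≥ 3`): there are
`θ > 0` and `N > 0` with `R(l - 1, n) ≤ R(l, n) / n ^ θ` for all `n > N`. -/
def RamseyGap (l : ℕ) : Prop :=
  ∃ θ : ℝ, 0 < θ ∧ ∃ N : ℕ, 0 < N ∧ ∀ n : ℕ, N < n →
    (ramseyR (l - 1) n : ℝ) ≤ (ramseyR l n : ℝ) / (n : ℝ) ^ θ

/-- The Ramsey–Turán function `RT(n, H, x)`: the maximum number of edges of an `H`-free graph on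
`n` vertices with independence number less than `x`; it is `0` if there is no such graph. -/
noncomputable def ramseyTuran {V : Type*} (n : ℕ) (H : SimpleGraph V) (x : ℝ) : ℕ :=
  sSup {e : ℕ | ∃ G : SimpleGraph (Fin n),
    H.Free G ∧ (G.indepNum : ℝ) < x ∧ G.edgeSet.ncard = e}

/-- The upper Ramsey–Turán density of `H` with respect to `f`. The sequence has its values in
`[0, 1/2]`, so the real `limsup` is the usual one. -/
noncomputable def upperRTDensity {V : Type*} (H : SimpleGraph V) (f : ℕ → ℝ) : ℝ :=
  limsup (fun n : ℕ => (ramseyTuran n H (f n) : ℝ) / (n : ℝ) ^ 2) atTop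

/-- The lower Ramsey–Turán density of `H` with respect to `f`. -/
noncomputable def lowerRTDensity {V : Type*} (H : SimpleGraph V) (f : ℕ → ℝ) : ℝ :=
  liminf (fun n : ℕ => (ramseyTuran n H (f n) : ℝ) / (n : ℝ) ^ 2) atTop

/-- `H` has a phase transition from `f` to `g`. The notion is meant for functions `g ≤ f`; the
inequality is not a conjunct here, so that the negation always says that the densities do not
drop and never holds merely because `g ≤ f` fails. -/
def HasPhaseTransition {V : Type*} (H : SimpleGraph V) (f g : ℕ → ℝ) : Prop :=
  upperRTDensity H g < lowerRTDensity H f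

/-- `H` has a `φ`-phase-transition at `f`, where `φ n → 0`. -/
def HasPhiPhaseTransition {V : Type*} (H : SimpleGraph V) (φ f : ℕ → ℝ) : Prop :=
  Tendsto φ atTop (𝓝 0) ∧ HasPhaseTransition H f (fun n => φ n * f n)

/-- `H` has a weak phase transition at `f`: for some `ε > 0` it has a `φ`-phase-transition at `f`
with `φ n = 2 ^ (-(log₂ n) ^ (1 - ε))`. -/
def HasWeakPhaseTransition {V : Type*} (H : SimpleGraph V) (f : ℕ → ℝ) : Prop :=
  ∃ ε : ℝ, 0 < ε ∧
    HasPhiPhaseTransition H (fun n : ℕ => (2 : ℝ) ^ (-((Real.logb 2 (n : ℝ)) ^ (1 - ε)))) f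

/-- The function `φ_ε(n) = 2 ^ (-ω(n) (log₂ n) ^ (1 - ε))`. -/
noncomputable def phiEps (ω : ℕ → ℝ) (ε : ℝ) (n : ℕ) : ℝ :=
  (2 : ℝ) ^ (-(ω n * (Real.logb 2 (n : ℝ)) ^ (1 - ε)))

/-!
`Q(t, ·)` is subadditive up to constants, so if `α(G)` is below `φ(n) Q(t, n)` then every set of
about `φ(n) n` vertices contains a `K_t`. If `G` also has more than
`(1 - 1 / k) n ^ 2 / 2 + o(n ^ 2)` edges, then a positive proportion of its `(k + 1)`-tuples span
cliques. Dependent random choice, applied to one coordinate after the other, replaces each vertex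
of such a tuple by a whole `K_t` and produces a `K_{(k + 1) t}`. Letting the number of samples grow
geometrically in `(log n) ^ (1 / (k + 1))` from one coordinate to the next balances all rounds, and
this is where `ε = 1 / (k + 1)` comes from.

With `k = ⌊(s - 1) / t⌋` this bounds the density below `φ Q(t, ·)` by `(1 - 1 / k) / 2`.
Conversely, the join of `k` extremal `K_{t + 1}`-free graphs is `K_s`-free, and since `Q(t + 1, ·)`
is unbounded, `Q(t + 1, m) < Q(t + 1, k m)` for infinitely many `m`; hence the density at
`Q(t + 1, ·)` is at least `(1 - 1 / k) / 2`, and no further drop is possible.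
-/

open Finset
open scoped BigOperators

section Proportion

variable {α β V : Type*} [Fintype α] [Fintype β] [Fintype V]

open Classical in
/-- The proportion of the elements of `α` that satisfy `p`, i.e. the probability that a uniformly
random element satisfies `p`. It is `0` if `α` is empty. -/
noncomputable def proportion (p : α → Prop) : ℝ :=
  𝔼 x, if p x then 1 else 0

theorem proportion_nonneg (p : α → Prop) : 0 ≤ proportion p :=
  expect_nonneg fun x _ => by positivity

theorem proportion_eq_card_div_card (p : α → Prop) [DecidablePred p] :
    proportion p = #{x | p x} / Fintype.card α := by
  rw [proportion, Fintype.expect_eq_sum_div_card, ← sum_boole]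
  congr!

theorem proportion_le_one (p : α → Prop) : proportion p ≤ 1 := by
  classical
  rw [proportion_eq_card_div_card]
  exact div_le_one_of_le₀ (by exact_mod_cast card_le_univ _) (Nat.cast_nonneg _)

theorem inv_card_le_proportion {p : α → Prop} (h : ∃ x, p x) :
    (Fintype.card α : ℝ)⁻¹ ≤ proportion p := by
  classical
  obtain ⟨x, hx⟩ := h
  rw [proportion_eq_card_div_card, inv_eq_one_div]
  gcongr
  exact_mod_cast card_pos.2 ⟨x, by simpa using hx⟩

theorem proportion_injective_fin_two [Nonempty α] :
    (proportion fun x : Fin 2 → α => Function.Injective x) = 1 - 1 / Fintype.card α := by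
  classical
  have hcard : #{x : Fin 2 → α | Function.Injective x} =
      Fintype.card α * (Fintype.card α - 1) := by
    rw [← Fintype.card_subtype, Fintype.card_congr (Equiv.subtypeInjectiveEquivEmbedding _ _),
      Fintype.card_embedding_eq]
    simp [Nat.descFactorial, mul_comm]
  have hpos : 0 < Fintype.card α := Fintype.card_pos
  rw [proportion_eq_card_div_card, hcard]
  simp only [Fintype.card_fun, Fintype.card_fin]
  push_cast [Nat.cast_sub hpos]
  field_simp

theorem exists_of_proportion_pos {p : α → Prop} (h : 0 < proportion p) : ∃ x, p x := by
  by_contra! hp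
  simp [proportion, hp] at h

theorem proportion_equiv (e : α ≃ β) (p : β → Prop) :
    proportion (fun x => p (e x)) = proportion p :=
  Fintype.expect_equiv e _ _ fun _ => rfl

theorem proportion_prod (p : α × β → Prop) :
    proportion p = 𝔼 a, proportion fun b => p (a, b) :=
  expect_product univ univ _

theorem proportion_forall (p : α → Prop) (q : ℕ) :
    proportion (fun w : Fin q → α => ∀ i, p (w i)) = proportion p ^ q := by
  classical
  have hcard : #{w : Fin q → α | ∀ i, p (w i)} = #{x | p x} ^ q := by
    rw [← Fintype.card_piFinset_const]
    congr 1
    ext w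
    simp
  rw [proportion_eq_card_div_card, proportion_eq_card_div_card, hcard, div_pow]
  simp

theorem proportion_comp_embedding [DecidableEq α] [DecidableEq β] [Nonempty V] (ι : β ↪ α)
    (p : (β → V) → Prop) :
    proportion (fun φ : α → V => p (φ ∘ ι)) = proportion p := by
  classical
  let e : (α → V) ≃ (β → V) × ({a // a ∉ Set.range ι} → V) :=
    (Equiv.piEquivPiSubtypeProd (· ∈ Set.range ι) fun _ => V).trans
      (((Equiv.ofInjective ι ι.injective).arrowCongr (Equiv.refl V)).symm.prodCongr (Equiv.refl _))
  calc proportion (fun φ : α → V => p (φ ∘ ι)) = proportion fun x => p (e x).1 := rfl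
    _ = proportion fun y : (β → V) × ({a // a ∉ Set.range ι} → V) => p y.1 :=
      proportion_equiv e fun y => p y.1
    _ = proportion p :=
      (proportion_prod _).trans (expect_congr rfl fun x _ =>
        Fintype.expect_const (if p x then (1 : ℝ) else 0))

theorem expect_card_filter {ι : Type*} (s : Finset ι) (r : α → ι → Prop)
    [∀ a, DecidablePred (r a)] :
    𝔼 a, (#{i ∈ s | r a i} : ℝ) = ∑ i ∈ s, proportion fun a => r a i := by
  simp only [← sum_boole]
  rw [expect_sum_comm]
  exact sum_congr rfl fun i _ => expect_congr rfl fun a _ => by congr!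

end Proportion

/-! ### Dependent random choice -/

section DependentRandomChoice

variable {V W : Type*} [Fintype V] [Fintype W]

theorem pow_expect_le_expect_pow [Nonempty V] {f : V → ℝ} (hf : ∀ v, 0 ≤ f v) (q : ℕ) :
    (𝔼 v, f v) ^ q ≤ 𝔼 v, f v ^ q := by
  simp only [Fintype.expect_eq_sum_div_card, div_eq_inv_mul, mul_sum]
  exact Real.pow_arith_mean_le_arith_mean_pow _ _ _ (fun _ _ => by positivity) (by simp)
    (fun v _ => hf v) q

open Classical in
theorem exists_tuple_le_card_sub_card [Nonempty W] (R : V → W → Prop) (𝓑 : Finset (Finset V))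
    (q : ℕ) :
    ∃ w : Fin q → W,
      Fintype.card V * (proportion fun x : V × W => R x.1 x.2) ^ q
          - ∑ T ∈ 𝓑, (proportion fun y => ∀ v ∈ T, R v y) ^ q
        ≤ (#{v | ∀ i, R v (w i)} : ℝ) - #{T ∈ 𝓑 | ∀ i, ∀ v ∈ T, R v (w i)} := by
  have hJensen : Fintype.card V * (proportion fun x : V × W => R x.1 x.2) ^ q ≤
      ∑ v, proportion (R v) ^ q := by
    cases isEmpty_or_nonempty V
    · simp
    rw [← Fintype.card_mul_expect, proportion_prod]
    gcongr
    exact pow_expect_le_expect_pow (fun v => proportion_nonneg _) q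
  suffices h : Fintype.card V * (proportion fun x : V × W => R x.1 x.2) ^ q
          - ∑ T ∈ 𝓑, (proportion fun y => ∀ v ∈ T, R v y) ^ q
        ≤ 𝔼 w : Fin q → W,
          ((#{v | ∀ i, R v (w i)} : ℝ) - #{T ∈ 𝓑 | ∀ i, ∀ v ∈ T, R v (w i)}) by
    obtain ⟨w, -, hw⟩ := exists_le_of_le_expect univ_nonempty h
    exact ⟨w, hw⟩
  rw [expect_sub_distrib, expect_card_filter, expect_card_filter]
  have hcommon (T : Finset V) : (proportion fun w : Fin q → W => ∀ i, ∀ v ∈ T, R v (w i)) =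
      (proportion fun y => ∀ v ∈ T, R v y) ^ q :=
    proportion_forall (fun y => ∀ v ∈ T, R v y) q
  simp only [proportion_forall (R _), hcommon]
  exact sub_le_sub_right hJensen _

theorem exists_subset_card_le_forall_not_subset {α : Type*} (A : Finset α)
    {𝓑 : Finset (Finset α)} (h𝓑 : ∀ T ∈ 𝓑, T.Nonempty) :
    ∃ U ⊆ A, #A ≤ #U + #𝓑 ∧ ∀ T ∈ 𝓑, ¬T ⊆ U := by
  classical
  choose f hf using h𝓑
  let X : Finset α := 𝓑.attach.image fun T => f T.1 T.2
  refine ⟨A \ X, sdiff_subset, ?_, fun T hT hTU => ?_⟩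
  · have hX : #X ≤ #𝓑 := card_image_le.trans_eq 𝓑.card_attach
    have := le_card_sdiff X A
    lia
  · exact (mem_sdiff.1 (hTU (hf T hT))).2 (mem_image_of_mem _ (mem_attach 𝓑 ⟨T, hT⟩))

theorem exists_large_subset_forall_common_proportion [Nonempty W] (R : V → W → Prop) {δ : ℝ}
    {q t : ℕ} (ht : 1 ≤ t) (hδ : 0 ≤ δ) (hV : (Fintype.card V : ℝ) ^ t * δ ^ q ≤ 1) :
    ∃ U : Finset V,
      Fintype.card V * (proportion fun x : V × W => R x.1 x.2) ^ q - 1 ≤ #U ∧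
        ∀ T ⊆ U, #T = t → δ ≤ proportion fun y => ∀ v ∈ T, R v y := by
  classical
  let 𝓑 : Finset (Finset V) :=
    {T ∈ powersetCard t univ | (proportion fun y => ∀ v ∈ T, R v y) < δ}
  have hbad : ∑ T ∈ 𝓑, (proportion fun y => ∀ v ∈ T, R v y) ^ q ≤ 1 :=
    calc ∑ T ∈ 𝓑, (proportion fun y => ∀ v ∈ T, R v y) ^ q ≤ ∑ _T ∈ 𝓑, δ ^ q := by
          refine sum_le_sum fun T hT => ?_
          gcongr
          · exact proportion_nonneg _
          · exact (mem_filter.1 hT).2.le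
      _ = #𝓑 * δ ^ q := by rw [sum_const, nsmul_eq_mul]
      _ ≤ (Fintype.card V : ℝ) ^ t * δ ^ q := by
          gcongr
          have : #𝓑 ≤ (Fintype.card V).choose t := by
            simpa using card_filter_le (powersetCard t (univ : Finset V)) _
          exact_mod_cast this.trans (Nat.choose_le_pow _ _)
      _ ≤ 1 := hV
  obtain ⟨w, hw⟩ := exists_tuple_le_card_sub_card R 𝓑 q
  set A : Finset V := {v | ∀ i, R v (w i)}
  set 𝓑A : Finset (Finset V) := {T ∈ 𝓑 | ∀ i, ∀ v ∈ T, R v (w i)}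
  obtain ⟨U, hUA, hcard, hU⟩ := exists_subset_card_le_forall_not_subset A (𝓑 := 𝓑A)
    fun T hT => by
      rw [← card_pos, (mem_powersetCard.1 (mem_filter.1 (mem_filter.1 hT).1).1).2]
      exact ht
  refine ⟨U, ?_, fun T hTU hTt => ?_⟩
  · have : (#A : ℝ) ≤ #U + #𝓑A := by exact_mod_cast hcard
    linarith
  · by_contra! hlt
    refine hU T (mem_filter.2 ⟨mem_filter.2 ⟨by simp [hTt], hlt⟩, fun i v hv => ?_⟩) hTU
    exact (mem_filter.1 (hUA (hTU hv))).2 i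

theorem exists_piFinset_of_le_proportion [Nonempty V] {P : Finset V → Prop} {t : ℕ} (ht : 1 ≤ t)
    {m : ℝ} (hm : ∀ U : Finset V, m ≤ #U → ∃ T ⊆ U, #T = t ∧ P T)
    {δ : ℕ → ℝ} {q : ℕ → ℕ} (hδ : ∀ j, 0 < δ j) (r : ℕ)
    (hV : ∀ j < r, (Fintype.card V : ℝ) ^ t * δ j ^ q j ≤ 1)
    (hU : ∀ j < r, m ≤ Fintype.card V * δ (j + 1) ^ q j - 1)
    (H : (Fin r → V) → Prop) (hH : δ r ≤ proportion H) :
    ∃ T : Fin r → Finset V, (∀ i, P (T i)) ∧ ∀ x ∈ Fintype.piFinset T, H x := by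
  induction r with
  | zero =>
    obtain ⟨y, hy⟩ := exists_of_proportion_pos ((hδ 0).trans_le hH)
    exact ⟨isEmptyElim, isEmptyElim, fun x _ => Subsingleton.elim y x ▸ hy⟩
  | succ r ih =>
    have hcons : proportion H =
        proportion fun y : V × (Fin r → V) => H (Fin.cons y.1 y.2) :=
      (proportion_equiv (Fin.consEquiv fun _ => V) H).symm
    obtain ⟨U, hUcard, hUT⟩ := exists_large_subset_forall_common_proportion
      (fun v (y : Fin r → V) => H (Fin.cons v y)) ht (hδ r).le (hV r r.lt_succ_self)
    have hmU : m ≤ #U := by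
      refine ((hU r r.lt_succ_self).trans ?_).trans hUcard
      have := (hδ (r + 1)).le
      rw [← hcons]
      gcongr
    obtain ⟨T₀, hT₀U, hT₀t, hT₀⟩ := hm U hmU
    obtain ⟨T, hT, hTH⟩ := ih (fun j hj => hV j (by lia)) (fun j hj => hU j (by lia))
      (fun y => ∀ v ∈ T₀, H (Fin.cons v y)) (hUT T₀ hT₀U hT₀t)
    refine ⟨Fin.cons T₀ T, Fin.cases hT₀ hT, fun x hx => ?_⟩
    simp only [Fintype.mem_piFinset, Fin.forall_fin_succ, Fin.cons_zero, Fin.cons_succ] at hx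
    simpa using hTH (Fin.tail x) (Fintype.mem_piFinset.2 hx.2) (x 0) hx.1

theorem exists_piFinset_of_two_rpow_le_proportion [Nonempty V] {P : Finset V → Prop}
    {t k : ℕ} (ht : 1 ≤ t) {C x : ℝ} (hC : 1 ≤ C) (hx : 2 * t * C + 1 ≤ x)
    (hV : (Fintype.card V : ℝ) = 2 ^ (x ^ (k + 1)))
    (hP : ∀ U : Finset V, (2 : ℝ) ^ (-((2 * t * C + 1) * x ^ k)) * Fintype.card V ≤ #U →
      ∃ T ⊆ U, #T = t ∧ P T)
    {H : (Fin (k + 1) → V) → Prop} (hH : 2 ^ (-C) ≤ proportion H) :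
    ∃ T : Fin (k + 1) → Finset V, (∀ i, P (T i)) ∧ ∀ y ∈ Fintype.piFinset T, H y := by
  have ht' : (1 : ℝ) ≤ t := by exact_mod_cast ht
  have hx1 : 1 ≤ x := by nlinarith
  -- With `j` coordinates left the density is `δ j`, and the next step samples `q j` times.
  let δ : ℕ → ℝ := fun j => 2 ^ (-(C * x ^ (k + 1 - j)))
  let q : ℕ → ℕ := fun j => ⌈t * x ^ j⌉₊
  have hδq (i j : ℕ) : δ i ^ q j = 2 ^ (-(C * x ^ (k + 1 - i) * q j)) := by
    rw [← Real.rpow_mul_natCast two_pos.le, neg_mul]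
  refine exists_piFinset_of_le_proportion ht hP (δ := δ) (q := q) (fun j => by positivity) (k + 1)
    (fun j hj => ?_) (fun j hj => ?_) H (by simpa [δ] using hH)
  · have hexp : t * x ^ (k + 1) ≤ C * x ^ (k + 1 - j) * q j :=
      calc t * x ^ (k + 1) = 1 * x ^ (k + 1 - j) * (t * x ^ j) := by
            rw [← pow_sub_mul_pow x hj.le]; ring
        _ ≤ C * x ^ (k + 1 - j) * q j := by gcongr; exact Nat.le_ceil _
    rw [hV, hδq, ← Real.rpow_mul_natCast two_pos.le, ← Real.rpow_add two_pos, mul_comm (x ^ _)]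
    exact Real.rpow_le_one_of_one_le_of_nonpos one_le_two (by linarith)
  · have hq : (q j : ℝ) ≤ 2 * (t * x ^ j) := by
      have := Nat.ceil_lt_add_one (a := t * x ^ j) (by positivity)
      have := one_le_mul_of_one_le_of_one_le ht' (one_le_pow₀ (n := j) hx1)
      linarith
    have hexp : C * x ^ (k + 1 - (j + 1)) * q j ≤ 2 * t * C * x ^ k :=
      calc C * x ^ (k + 1 - (j + 1)) * q j ≤ C * x ^ (k - j) * (2 * (t * x ^ j)) := by
            rw [Nat.add_sub_add_right]; gcongr
        _ = 2 * t * C * x ^ k := by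
            rw [← pow_sub_mul_pow x (Nat.le_of_lt_succ hj)]; ring
    have hsmall : 1 ≤ (2 : ℝ) ^ (-((2 * t * C + 1) * x ^ k) + x ^ (k + 1)) := by
      refine Real.one_le_rpow one_le_two ?_
      rw [pow_succ']
      nlinarith [one_le_pow₀ (n := k) hx1]
    rw [hV, hδq, ← Real.rpow_add two_pos, ← Real.rpow_add two_pos, le_sub_iff_add_le]
    calc _ ≤ (2 : ℝ) ^ (-((2 * t * C + 1) * x ^ k) + x ^ (k + 1)) * 2 := by linarith
      _ = (2 : ℝ) ^ (-((2 * t * C + 1) * x ^ k) + x ^ (k + 1) + 1) := by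
          rw [Real.rpow_add_one two_ne_zero]
      _ ≤ _ := by
          refine Real.rpow_le_rpow_of_exponent_le one_le_two ?_
          linarith [one_le_pow₀ (n := k) hx1]

end DependentRandomChoice

/-! ### Homomorphism densities and supersaturation -/

section HomDensity

variable {V W α : Type*} [Fintype V] [Fintype W] [DecidableEq W] [Fintype α]

/-- The homomorphism density `t(F, G)`: the probability that a uniformly random map from the
vertices of `F` to those of `G` is a graph homomorphism. -/
noncomputable def homDensity (F : SimpleGraph W) (G : SimpleGraph V) : ℝ :=
  proportion fun φ : W → V => F ≤ G.comap φ

theorem expect_homDensity_comap [DecidableEq α] [Nonempty V] (G : SimpleGraph V) :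
    𝔼 φ : α → V, homDensity (⊤ : SimpleGraph W) (G.comap φ) =
      (proportion fun x : W → α => Function.Injective x) * homDensity (⊤ : SimpleGraph W) G := by
  classical
  have hfix (x : W → α) : (proportion fun φ : α → V => ⊤ ≤ (G.comap φ).comap x) =
      (if Function.Injective x then 1 else 0) * homDensity (⊤ : SimpleGraph W) G := by
    split_ifs with hx
    · rw [one_mul]
      exact proportion_comp_embedding ⟨x, hx⟩ fun y => (⊤ : SimpleGraph W) ≤ G.comap y
    · have hnot (φ : α → V) : ¬(⊤ : SimpleGraph W) ≤ (G.comap φ).comap x := fun hle =>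
        hx (SimpleGraph.Hom.injective_of_top_hom (G' := G.comap φ) ⟨x, fun h => hle h⟩)
      simp only [proportion, hnot, if_false, zero_mul, expect_const_zero]
  calc 𝔼 φ : α → V, homDensity (⊤ : SimpleGraph W) (G.comap φ)
      = 𝔼 x : W → α, proportion fun φ : α → V => ⊤ ≤ (G.comap φ).comap x := expect_comm ..
    _ = _ := by
      rw [expect_congr rfl fun x _ => hfix x, ← expect_mul, proportion]
      congr!

theorem homDensity_top_fin_two_mul_card_sq (G : SimpleGraph V) :
    homDensity (⊤ : SimpleGraph (Fin 2)) G * Fintype.card V ^ 2 = 2 * G.edgeSet.ncard := by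
  classical
  have hpair (φ : Fin 2 → V) : ⊤ ≤ G.comap φ ↔ G.Adj (φ 0) (φ 1) := by
    refine ⟨fun h => h (by simp : (⊤ : SimpleGraph (Fin 2)).Adj 0 1), fun h i j hij => ?_⟩
    fin_cases i <;> fin_cases j <;> simp_all [G.adj_comm]
  have hcard : #{p : V × V | G.Adj p.1 p.2} = 2 * G.edgeSet.ncard := by
    rw [← SimpleGraph.coe_edgeFinset, Set.ncard_coe_finset, ← G.dart_card_eq_twice_card_edges,
      ← Fintype.card_subtype]
    exact Fintype.card_congr
      ⟨fun p => ⟨p.1, p.2⟩, fun d => ⟨d.toProd, d.adj⟩, fun _ => rfl, fun _ => rfl⟩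
  have hprop : homDensity (⊤ : SimpleGraph (Fin 2)) G =
      proportion fun p : V × V => G.Adj p.1 p.2 := by
    rw [← proportion_equiv (finTwoArrowEquiv V), homDensity]
    simp only [hpair]
    rfl
  cases isEmpty_or_nonempty V
  · simp [Set.ncard_eq_toFinset_card', Subsingleton.elim G ⊥]
  · rw [hprop, proportion_eq_card_div_card, hcard, Fintype.card_prod]
    push_cast
    field_simp

theorem homDensity_top_fin_two_le_of_cliqueFree {G : SimpleGraph V} {k : ℕ} (hk : 0 < k)
    (h : G.CliqueFree (k + 1)) : homDensity (⊤ : SimpleGraph (Fin 2)) G ≤ 1 - 1 / k := by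
  classical
  obtain ⟨M, _, hM⟩ := SimpleGraph.exists_isTuranMaximal (V := V) hk
  have hTuran : k * (2 * G.edgeSet.ncard) ≤ (k - 1) * Fintype.card V ^ 2 := by
    obtain ⟨e⟩ := (SimpleGraph.isTuranMaximal_iff_nonempty_iso_turanGraph hk).1 hM
    rw [← SimpleGraph.coe_edgeFinset, Set.ncard_coe_finset, mul_left_comm, ← mul_assoc]
    refine le_trans ?_
      (SimpleGraph.mul_card_edgeFinset_turanGraph_le (n := Fintype.card V) (r := k))
    rw [← e.card_edgeFinset_eq]
    exact Nat.mul_le_mul_left _ (hM.2 h)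
  have hTuran' : k * (homDensity (⊤ : SimpleGraph (Fin 2)) G * Fintype.card V ^ 2) ≤
      (k - 1) * (Fintype.card V : ℝ) ^ 2 := by
    rw [homDensity_top_fin_two_mul_card_sq, ← Nat.cast_pred hk]
    exact_mod_cast hTuran
  have hk' : (0 : ℝ) < k := by exact_mod_cast hk
  cases isEmpty_or_nonempty V
  · simpa [homDensity, proportion] using Nat.cast_inv_le_one k
  · have hV : 0 < (Fintype.card V : ℝ) ^ 2 := by positivity
    rw [one_sub_div hk'.ne', le_div_iff₀' hk']
    exact le_of_mul_le_mul_right (by linarith) hV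

theorem homDensity_top_fin_two_le_add [Nonempty V] (G : SimpleGraph V) {k : ℕ} (hk : 0 < k) :
    homDensity (⊤ : SimpleGraph (Fin 2)) G ≤
      1 - 1 / k + Fintype.card V ^ (k + 1) * homDensity (⊤ : SimpleGraph (Fin (k + 1))) G := by
  by_cases h : G.CliqueFree (k + 1)
  · refine (homDensity_top_fin_two_le_of_cliqueFree hk h).trans (le_add_of_nonneg_right ?_)
    exact mul_nonneg (by positivity) (proportion_nonneg _)
  · have hclique : 1 ≤
        Fintype.card V ^ (k + 1) * homDensity (⊤ : SimpleGraph (Fin (k + 1))) G := by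
      rw [← inv_le_iff_one_le_mul₀' (by positivity)]
      let f := SimpleGraph.topEmbeddingOfNotCliqueFree h
      have hf : ⊤ ≤ G.comap f := fun i j hij => f.map_rel_iff.2 hij
      simpa [homDensity] using inv_card_le_proportion (p := fun φ => ⊤ ≤ G.comap φ) ⟨f, hf⟩
    have := Nat.one_sub_one_div_cast_nonneg (α := ℝ) k
    have := proportion_le_one fun φ : Fin 2 → V => ⊤ ≤ G.comap φ
    exact this.trans (by linarith)

theorem one_sub_one_div_mul_homDensity_le [Nonempty V] (G : SimpleGraph V) {k m : ℕ} (hk : 0 < k)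
    (hm : 0 < m) :
    (1 - 1 / m) * homDensity (⊤ : SimpleGraph (Fin 2)) G ≤
      1 - 1 / k + m ^ (k + 1) * homDensity (⊤ : SimpleGraph (Fin (k + 1))) G := by
  have : NeZero m := ⟨hm.ne'⟩
  -- Apply `homDensity_top_fin_two_le_add` to the graph induced by `m` random vertices.
  have havg : 𝔼 φ : Fin m → V, homDensity (⊤ : SimpleGraph (Fin 2)) (G.comap φ) ≤
      𝔼 φ : Fin m → V, (1 - 1 / k +
        m ^ (k + 1) * homDensity (⊤ : SimpleGraph (Fin (k + 1))) (G.comap φ)) :=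
    expect_le_expect fun φ _ => by
      simpa using homDensity_top_fin_two_le_add (G.comap φ) hk
  rw [expect_add_distrib, Fintype.expect_const, ← mul_expect, expect_homDensity_comap,
    expect_homDensity_comap, proportion_injective_fin_two, Fintype.card_fin] at havg
  have hclique : (proportion fun x : Fin (k + 1) → Fin m => Function.Injective x) *
        homDensity (⊤ : SimpleGraph (Fin (k + 1))) G ≤
      homDensity (⊤ : SimpleGraph (Fin (k + 1))) G :=
    mul_le_of_le_one_left (proportion_nonneg _) (proportion_le_one _)
  exact havg.trans (by gcongr)

theorem exists_pos_le_homDensity_top {k : ℕ} (hk : 0 < k) {η : ℝ} (hη : 0 < η) :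
    ∃ c : ℝ, 0 < c ∧ ∀ (V : Type*) [Fintype V] (G : SimpleGraph V),
      1 - 1 / k + η ≤ homDensity (⊤ : SimpleGraph (Fin 2)) G →
        c ≤ homDensity (⊤ : SimpleGraph (Fin (k + 1))) G := by
  obtain ⟨m, hm⟩ := exists_nat_ge (2 / η)
  have hm0 : (0 : ℝ) < m := (by positivity : 0 < 2 / η).trans_le hm
  have hmη : 1 / m ≤ η / 2 := by
    rw [div_le_div_iff₀ hm0 two_pos]
    rw [div_le_iff₀ hη] at hm
    linarith
  refine ⟨(η / 2) / m ^ (k + 1), by positivity, fun V _ G hG => ?_⟩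
  have : Nonempty V := by
    have hpos : 0 < homDensity (⊤ : SimpleGraph (Fin 2)) G :=
      (add_pos_of_nonneg_of_pos (Nat.one_sub_one_div_cast_nonneg k) hη).trans_le hG
    obtain ⟨φ, -⟩ := exists_of_proportion_pos hpos
    exact ⟨φ 0⟩
  have hedge : homDensity (⊤ : SimpleGraph (Fin 2)) G ≤ 1 := proportion_le_one _
  have hloss := mul_le_mul hmη hedge (proportion_nonneg _) (by positivity)
  have hsample := one_sub_one_div_mul_homDensity_le G hk (Nat.cast_pos.1 hm0)
  rw [div_le_iff₀' (by positivity)]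
  linarith

end HomDensity

/-! ### Independence numbers and inverse Ramsey numbers -/

section CliqueNum

open SimpleGraph

variable {V W ι : Type*} [Finite V] [Finite W]

theorem cliqueNum_lt_iff_cliqueFree {G : SimpleGraph V} {n : ℕ} :
    G.cliqueNum < n ↔ G.CliqueFree n := by
  obtain ⟨S, hS⟩ := G.exists_isNClique_cliqueNum
  refine ⟨fun h T hT => ?_, fun h => ?_⟩
  · exact (hT.isClique.card_le_cliqueNum.trans_lt h).ne hT.card_eq
  · by_contra! hn
    exact h.mono hn S hS

theorem cliqueNum_le_of_hom {G : SimpleGraph V} {H : SimpleGraph W} (f : G →g H) :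
    G.cliqueNum ≤ H.cliqueNum := by
  rw [← Nat.lt_succ_iff, cliqueNum_lt_iff_cliqueFree]
  by_contra hG
  let g := f.comp (topEmbeddingOfNotCliqueFree hG).toHom
  have hH : ¬H.CliqueFree (H.cliqueNum + 1) :=
    (not_cliqueFree_iff_top_isContained _).2 ⟨g.toCopy g.injective_of_top_hom⟩
  exact hH (cliqueNum_lt_iff_cliqueFree.1 (Nat.lt_succ_self _))

theorem indepNum_le_of_embedding {G : SimpleGraph V} {H : SimpleGraph W} (f : G ↪g H) :
    G.indepNum ≤ H.indepNum := by
  rw [← cliqueNum_compl, ← cliqueNum_compl]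
  exact cliqueNum_le_of_hom (Embedding.complEquiv f).toHom

theorem cliqueNum_bot_boxProd_le [Finite ι] (G : SimpleGraph V) :
    ((⊥ : SimpleGraph ι) □ G).cliqueNum ≤ G.cliqueNum :=
  cliqueNum_le_of_hom ⟨Prod.snd, fun h => by simpa [boxProd_adj] using h.imp_right And.left⟩

theorem indepNum_bot_boxProd_le [Fintype ι] (G : SimpleGraph V) :
    ((⊥ : SimpleGraph ι) □ G).indepNum ≤ Fintype.card ι * G.indepNum := by
  classical
  obtain ⟨S, hS⟩ := ((⊥ : SimpleGraph ι) □ G).exists_isNIndepSet_indepNum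
  rw [← hS.card_eq, mul_comm]
  refine card_le_mul_card_image_of_maps_to (f := Prod.fst) (t := univ) (fun _ _ => mem_univ _) _
    fun i _ => ?_
  rw [← card_image_of_injOn (f := Prod.snd) fun x hx y hy h =>
    Prod.ext ((mem_filter.1 hx).2.trans (mem_filter.1 hy).2.symm) h]
  refine IsIndepSet.card_le_indepNum ?_
  simp only [coe_image, coe_filter]
  rintro _ ⟨⟨_, v⟩, ⟨hv, rfl⟩, rfl⟩ _ ⟨⟨_, w⟩, ⟨hw, rfl⟩, rfl⟩ hvw hadj
  exact hS.isIndepSet hv hw (by simpa using hvw) (boxProd_adj.2 (Or.inr ⟨hadj, rfl⟩))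

end CliqueNum

section RamseyQ

variable {V : Type*} {t : ℕ}

theorem ramseyQ_card_le_indepNum [Fintype V] {G : SimpleGraph V} (hG : G.CliqueFree t) :
    ramseyQ t (Fintype.card V) ≤ G.indepNum := by
  let f := SimpleGraph.Embedding.comap (Fintype.equivFin V).symm.toEmbedding G
  calc ramseyQ t (Fintype.card V) ≤ (G.comap (Fintype.equivFin V).symm).indepNum :=
        Nat.sInf_le ⟨_, hG.comap f.isContained, rfl⟩
    _ ≤ G.indepNum := indepNum_le_of_embedding f

theorem exists_cliqueFree_indepNum_eq_ramseyQ (ht : 2 ≤ t) (n : ℕ) :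
    ∃ G : SimpleGraph (Fin n), G.CliqueFree t ∧ G.indepNum = ramseyQ t n :=
  Nat.sInf_mem (s := {a | ∃ G : SimpleGraph (Fin n), G.CliqueFree t ∧ G.indepNum = a})
    ⟨_, ⊥, SimpleGraph.cliqueFree_bot ht, rfl⟩

theorem ramseyQ_card_le_indepNum_of_cliqueFreeOn [Finite V] {G : SimpleGraph V}
    {U : Finset V} (hU : G.CliqueFreeOn U t) : ramseyQ t #U ≤ G.indepNum := by
  have hQ := ramseyQ_card_le_indepNum ((SimpleGraph.cliqueFree_induce_iff G _ _).2 hU)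
  rw [← Fintype.card_coe U]
  exact hQ.trans (indepNum_le_of_embedding (SimpleGraph.Embedding.induce (U : Set V)))

theorem ramseyQ_le_mul (ht : 2 ≤ t) {n j a : ℕ} (h : n ≤ j * a) :
    ramseyQ t n ≤ j * ramseyQ t a := by
  obtain ⟨G, hG, hGa⟩ := exists_cliqueFree_indepNum_eq_ramseyQ ht a
  obtain ⟨U, -, rfl⟩ := exists_subset_card_eq (s := (univ : Finset (Fin j × Fin a))) (n := n)
    (by simpa using h)
  have hfree : ((⊥ : SimpleGraph (Fin j)) □ G).CliqueFree t :=
    cliqueNum_lt_iff_cliqueFree.1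
      ((cliqueNum_bot_boxProd_le G).trans_lt (cliqueNum_lt_iff_cliqueFree.2 hG))
  calc ramseyQ t #U ≤ ((⊥ : SimpleGraph (Fin j)) □ G).indepNum :=
        ramseyQ_card_le_indepNum_of_cliqueFreeOn hfree.cliqueFreeOn
    _ ≤ j * ramseyQ t a := by simpa [hGa] using indepNum_bot_boxProd_le (ι := Fin j) G

theorem ramseyQ_card_mul_card_le [Fintype V] (ht : 2 ≤ t) {G : SimpleGraph V}
    {U : Finset V} (hU : G.CliqueFreeOn U t) :
    ramseyQ t (Fintype.card V) * #U ≤ 2 * Fintype.card V * G.indepNum := by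
  rcases U.eq_empty_or_nonempty with rfl | hne
  · simp
  set j := Fintype.card V / #U + 1
  have hj : j * #U ≤ 2 * Fintype.card V := by
    have := Nat.div_mul_le_self (Fintype.card V) #U
    have := card_le_univ U
    lia
  have hVj : Fintype.card V ≤ j * #U := by
    have := Nat.lt_div_mul_add (a := Fintype.card V) hne.card_pos
    lia
  calc ramseyQ t (Fintype.card V) * #U ≤ j * G.indepNum * #U := by
        gcongr
        exact (ramseyQ_le_mul ht hVj).trans
          (Nat.mul_le_mul_left j (ramseyQ_card_le_indepNum_of_cliqueFreeOn hU))
    _ = j * #U * G.indepNum := by ring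
    _ ≤ 2 * Fintype.card V * G.indepNum := by gcongr

theorem card_lt_indepNum_succ_pow [Finite V] {G : SimpleGraph V} {U : Finset V}
    (hU : G.CliqueFreeOn U t) :
    #U < (G.indepNum + 1) ^ t := by
  classical
  induction t generalizing U with
  | zero =>
    exact absurd rfl ((SimpleGraph.cliqueFreeOn_empty G).1 (hU.subset G (Set.empty_subset _)))
  | succ t ih =>
    obtain ⟨S, hS⟩ : ∃ S : Finset V, Maximal (fun S => S ⊆ U ∧ G.IsIndepSet S) S :=
      Set.Finite.exists_maximal (Set.toFinite _) ⟨∅, empty_subset U, by simp⟩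
    have hcover : U ⊆ S.biUnion fun v => insert v (U.filter (G.Adj v)) := by
      intro u hu
      by_contra hnot
      simp only [mem_biUnion, mem_insert, mem_filter, not_exists, not_and, not_or] at hnot
      have huS : u ∈ S := hS.2 ⟨insert_subset hu hS.1.1, by
        rw [coe_insert]
        exact Set.Pairwise.insert hS.1.2 fun v hv _ =>
          ⟨fun hadj => (hnot v hv).2 hu hadj.symm, (hnot v hv).2 hu⟩⟩ (subset_insert u S)
          (mem_insert_self u S)
      exact (hnot u huS).1 rfl
    have hcard : ∀ v ∈ S, #(insert v (U.filter (G.Adj v))) ≤ (G.indepNum + 1) ^ t := by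
      intro v hv
      have hfree : G.CliqueFreeOn (U.filter (G.Adj v)) t := by
        rw [coe_filter]
        exact hU.of_succ G (hS.1.1 hv)
      exact (card_insert_le _ _).trans (ih hfree)
    calc #U ≤ #S * (G.indepNum + 1) ^ t :=
          (card_le_card hcover).trans (card_biUnion_le_card_mul _ _ _ hcard)
      _ ≤ G.indepNum * (G.indepNum + 1) ^ t := by
          gcongr
          exact hS.1.2.card_le_indepNum
      _ < (G.indepNum + 1) ^ (t + 1) := by
          rw [pow_succ']
          gcongr
          exact Nat.lt_succ_self _

theorem tendsto_ramseyQ (ht : 2 ≤ t) : Tendsto (ramseyQ t) atTop atTop := by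
  refine tendsto_atTop_atTop.2 fun b => ⟨(b + 1) ^ t, fun n hn => ?_⟩
  obtain ⟨G, hG, hGn⟩ := exists_cliqueFree_indepNum_eq_ramseyQ ht n
  have hlt := card_lt_indepNum_succ_pow (U := univ) hG.cliqueFreeOn
  rw [card_univ, Fintype.card_fin, hGn] at hlt
  exact Nat.succ_le_succ_iff.1 (lt_of_pow_lt_pow_left₀ t (Nat.zero_le _) (hn.trans_lt hlt)).le

end RamseyQ

theorem frequently_lt_comp_mul_of_tendsto_atTop {α : Type*} [LinearOrder α] [NoMaxOrder α]
    {f : ℕ → α} (hf : Tendsto f atTop atTop) {k : ℕ} (hk : 2 ≤ k) :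
    ∃ᶠ m in atTop, f m < f (k * m) := by
  by_contra! hle
  obtain ⟨N, hN⟩ := eventually_atTop.1 hle
  have hbdd (j : ℕ) : f (k ^ j * (N + 1)) ≤ f (N + 1) := by
    induction j with
    | zero => simp
    | succ j ih =>
      rw [pow_succ', mul_assoc]
      exact (hN _ ((Nat.le_succ N).trans (Nat.le_mul_of_pos_left _ (by positivity)))).trans ih
  have htop : Tendsto (fun j => k ^ j * (N + 1)) atTop atTop :=
    tendsto_atTop_mono (fun _ => Nat.le_mul_of_pos_right _ N.succ_pos)
      (tendsto_pow_atTop_atTop_of_one_lt hk)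
  obtain ⟨j, hj⟩ := ((hf.comp htop).eventually_gt_atTop (f (N + 1))).exists
  exact (hbdd j).not_gt hj

section JoinCopies

open SimpleGraph

variable {V ι : Type*}

/-- The join of disjoint copies of `G` indexed by `ι`: vertices in different copies are always
adjacent. -/
def joinCopies (ι : Type*) {V : Type*} (G : SimpleGraph V) : SimpleGraph (ι × V) :=
  ((⊥ : SimpleGraph ι) □ Gᶜ)ᶜ

theorem cliqueNum_joinCopies_le [Finite V] [Fintype ι] (G : SimpleGraph V) :
    (joinCopies ι G).cliqueNum ≤ Fintype.card ι * G.cliqueNum := by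
  rw [joinCopies, cliqueNum_compl, ← indepNum_compl]
  exact indepNum_bot_boxProd_le Gᶜ

theorem indepNum_joinCopies_le [Finite V] [Finite ι] (G : SimpleGraph V) :
    (joinCopies ι G).indepNum ≤ G.indepNum := by
  rw [joinCopies, indepNum_compl, ← cliqueNum_compl]
  exact cliqueNum_bot_boxProd_le Gᶜ

theorem le_two_mul_ncard_edgeSet_joinCopies [Fintype V] [Fintype ι] (G : SimpleGraph V) :
    Fintype.card ι * (Fintype.card ι - 1) * Fintype.card V ^ 2 ≤
      2 * (joinCopies ι G).edgeSet.ncard := by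
  classical
  have hdeg (p : ι × V) :
      (Fintype.card ι - 1) * Fintype.card V ≤ (joinCopies ι G).degree p := by
    have hGc := Gᶜ.degree_lt_card_verts p.2
    have hbox : ((⊥ : SimpleGraph ι) □ Gᶜ).degree p = Gᶜ.degree p.2 := by
      rw [degree_boxProd, bot_degree, zero_add]
    have hcompl : (joinCopies ι G).degree p =
        Fintype.card (ι × V) - 1 - ((⊥ : SimpleGraph ι) □ Gᶜ).degree p := by
      rw [← degree_compl]
      unfold joinCopies
      congr!
    rw [hcompl, hbox, Fintype.card_prod, Nat.sub_mul]
    lia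
  rw [← coe_edgeFinset, Set.ncard_coe_finset, ← sum_degrees_eq_twice_card_edges]
  calc Fintype.card ι * (Fintype.card ι - 1) * Fintype.card V ^ 2
      = ∑ _p : ι × V, (Fintype.card ι - 1) * Fintype.card V := by
        rw [sum_const, card_univ, Fintype.card_prod, smul_eq_mul]
        ring
    _ ≤ ∑ p, (joinCopies ι G).degree p := sum_le_sum fun p _ => hdeg p

end JoinCopies

/-! ### Ramsey–Turán densities -/

section RamseyTuran

variable {V : Type*} [Fintype V] {s : ℕ} {f : ℕ → ℝ} {c : ℝ}

theorem two_mul_ncard_edgeSet_le_sq (G : SimpleGraph V) :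
    2 * G.edgeSet.ncard ≤ Fintype.card V ^ 2 := by
  have h := homDensity_top_fin_two_mul_card_sq G
  have hle : (2 * G.edgeSet.ncard : ℝ) ≤ Fintype.card V ^ 2 := by
    rw [← h]
    exact mul_le_of_le_one_left (by positivity) (proportion_le_one _)
  exact_mod_cast hle

theorem cliqueFree_iff_top_fin_free {W : Type*} {G : SimpleGraph W} :
    G.CliqueFree s ↔ (⊤ : SimpleGraph (Fin s)).Free G := by
  simpa using SimpleGraph.cliqueFree_iff_top_free (G := G) (β := Fin s)

theorem ncard_edgeSet_le_ramseyTuran {G : SimpleGraph V} {x : ℝ} (hG : G.CliqueFree s)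
    (hα : G.indepNum < x) :
    G.edgeSet.ncard ≤ ramseyTuran (Fintype.card V) (⊤ : SimpleGraph (Fin s)) x := by
  let f := SimpleGraph.Iso.comap (Fintype.equivFin V).symm G
  refine le_csSup ⟨Fintype.card V ^ 2, ?_⟩ ⟨_, cliqueFree_iff_top_fin_free.1
    (hG.comap f.toEmbedding.isContained), ?_, ?_⟩
  · rintro _ ⟨G', -, -, rfl⟩
    have := two_mul_ncard_edgeSet_le_sq G'
    rw [Fintype.card_fin] at this
    lia
  · exact (Nat.cast_le.2 (indepNum_le_of_embedding f.toEmbedding)).trans_lt hα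
  · exact Nat.card_congr f.mapEdgeSet

theorem ramseyTuran_le {n : ℕ} {x b : ℝ} (hb : 0 ≤ b)
    (h : ∀ G : SimpleGraph (Fin n), G.CliqueFree s → G.indepNum < x → G.edgeSet.ncard ≤ b) :
    ramseyTuran n (⊤ : SimpleGraph (Fin s)) x ≤ b := by
  refine (Nat.le_floor_iff hb).1 (csSup_le' ?_)
  rintro _ ⟨G, hG, hα, rfl⟩
  exact Nat.le_floor (h G (cliqueFree_iff_top_fin_free.2 hG) hα)

theorem ramseyTuran_div_sq_le_half (n : ℕ) (x : ℝ) :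
    (ramseyTuran n (⊤ : SimpleGraph (Fin s)) x : ℝ) / (n : ℝ) ^ 2 ≤ 1 / 2 := by
  refine div_le_of_le_mul₀ (by positivity) (by positivity) (ramseyTuran_le (by positivity) ?_)
  intro G _ _
  have h : (2 * G.edgeSet.ncard : ℝ) ≤ n ^ 2 := by
    exact_mod_cast (Fintype.card_fin n) ▸ two_mul_ncard_edgeSet_le_sq G
  linarith

theorem isBoundedUnder_le_ramseyTuran_div_sq :
    IsBoundedUnder (· ≤ ·) atTop
      fun n : ℕ => (ramseyTuran n (⊤ : SimpleGraph (Fin s)) (f n) : ℝ) / (n : ℝ) ^ 2 :=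
  isBoundedUnder_of ⟨1 / 2, fun n => ramseyTuran_div_sq_le_half n (f n)⟩

theorem isBoundedUnder_ge_ramseyTuran_div_sq {W : Type*} {H : SimpleGraph W} :
    IsBoundedUnder (· ≥ ·) atTop fun n : ℕ => (ramseyTuran n H (f n) : ℝ) / (n : ℝ) ^ 2 :=
  isBoundedUnder_of ⟨0, fun n => by positivity⟩

theorem lowerRTDensity_le_upperRTDensity :
    lowerRTDensity (⊤ : SimpleGraph (Fin s)) f ≤ upperRTDensity (⊤ : SimpleGraph (Fin s)) f :=
  liminf_le_limsup isBoundedUnder_le_ramseyTuran_div_sq isBoundedUnder_ge_ramseyTuran_div_sq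

theorem le_upperRTDensity_of_frequently
    (h : ∃ᶠ n : ℕ in atTop,
      c ≤ (ramseyTuran n (⊤ : SimpleGraph (Fin s)) (f n) : ℝ) / (n : ℝ) ^ 2) :
    c ≤ upperRTDensity (⊤ : SimpleGraph (Fin s)) f :=
  le_limsup_of_frequently_le h isBoundedUnder_le_ramseyTuran_div_sq

theorem upperRTDensity_le_of_eventually (hc : 0 ≤ c)
    (h : ∀ᶠ n : ℕ in atTop, ∀ G : SimpleGraph (Fin n), G.CliqueFree s → G.indepNum < f n →
      G.edgeSet.ncard ≤ c * n ^ 2) :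
    upperRTDensity (⊤ : SimpleGraph (Fin s)) f ≤ c := by
  refine limsup_le_of_le isBoundedUnder_ge_ramseyTuran_div_sq.isCoboundedUnder_le ?_
  filter_upwards [h] with n hn
  exact div_le_of_le_mul₀ (by positivity) hc (ramseyTuran_le (by positivity) hn)

theorem upperRTDensity_nonneg : 0 ≤ upperRTDensity (⊤ : SimpleGraph (Fin s)) f :=
  le_upperRTDensity_of_frequently (Frequently.of_forall fun n => by positivity)

theorem upperRTDensity_ramseyQ_nonpos {t : ℕ} (hst : s ≤ t) :
    upperRTDensity (⊤ : SimpleGraph (Fin s)) (fun n => (ramseyQ t n : ℝ)) ≤ 0 := by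
  refine upperRTDensity_le_of_eventually le_rfl (.of_forall fun n G hG hα => ?_)
  have hQ := ramseyQ_card_le_indepNum (hG.mono hst)
  rw [Fintype.card_fin] at hQ
  exact absurd (Nat.cast_lt.1 hα) hQ.not_gt

theorem lt_of_hasPhaseTransition_ramseyQ {t : ℕ} {g : ℕ → ℝ}
    (h : HasPhaseTransition (⊤ : SimpleGraph (Fin s)) (fun n => (ramseyQ t n : ℝ)) g) :
    t < s := by
  by_contra! hst
  exact h.not_ge ((lowerRTDensity_le_upperRTDensity.trans (upperRTDensity_ramseyQ_nonpos hst)).trans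
    upperRTDensity_nonneg)

theorem one_sub_one_div_half_le_ramseyTuran_div_sq {t k m : ℕ} (ht : 2 ≤ t) (hk : 0 < k)
    (hm : 0 < m) (hs : k * (t - 1) < s) {x : ℝ} (hx : ramseyQ t m < x) :
    (1 - 1 / (k : ℝ)) / 2 ≤
      ramseyTuran (k * m) (⊤ : SimpleGraph (Fin s)) x / ((k * m : ℕ) : ℝ) ^ 2 := by
  obtain ⟨G, hG, hGm⟩ := exists_cliqueFree_indepNum_eq_ramseyQ ht m
  have hfree : (joinCopies (Fin k) G).CliqueFree s := by
    rw [← cliqueNum_lt_iff_cliqueFree] at hG ⊢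
    refine (cliqueNum_joinCopies_le G).trans_lt (lt_of_le_of_lt ?_ hs)
    rw [Fintype.card_fin]
    exact Nat.mul_le_mul_left k (Nat.le_sub_one_of_lt hG)
  have hα : ((joinCopies (Fin k) G).indepNum : ℝ) < x :=
    (Nat.cast_le.2 (hGm ▸ indepNum_joinCopies_le G)).trans_lt hx
  have hRT := ncard_edgeSet_le_ramseyTuran hfree hα
  have hedges := le_two_mul_ncard_edgeSet_joinCopies (ι := Fin k) G
  simp only [Fintype.card_fin, Fintype.card_prod] at hRT hedges
  have hle : (k : ℝ) * (k - 1) * m ^ 2 ≤ 2 * ramseyTuran (k * m) (⊤ : SimpleGraph (Fin s)) x := by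
    rw [← Nat.cast_pred hk]
    exact_mod_cast hedges.trans (Nat.mul_le_mul_left 2 hRT)
  rw [le_div_iff₀ (by positivity)]
  push_cast
  calc (1 - 1 / (k : ℝ)) / 2 * (k * m) ^ 2 = (k * (k - 1) * m ^ 2) / 2 := by field_simp
    _ ≤ _ := by linarith

theorem one_sub_one_div_half_le_upperRTDensity_ramseyQ {t k : ℕ} (ht : 2 ≤ t) (hk : 0 < k)
    (hs : k * (t - 1) < s) :
    (1 - 1 / (k : ℝ)) / 2 ≤
      upperRTDensity (⊤ : SimpleGraph (Fin s)) (fun n => (ramseyQ t n : ℝ)) := by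
  obtain rfl | hk2 := (Nat.succ_le_of_lt hk).eq_or_lt
  · simpa using upperRTDensity_nonneg
  have hmul : Tendsto (k * ·) atTop (atTop : Filter ℕ) := tendsto_id.const_mul_atTop' hk
  refine le_upperRTDensity_of_frequently (hmul.frequently ?_)
  refine ((frequently_lt_comp_mul_of_tendsto_atTop (tendsto_ramseyQ ht) hk2).and_eventually
    (eventually_gt_atTop 0)).mono fun m hm => ?_
  exact one_sub_one_div_half_le_ramseyTuran_div_sq ht hk hm.2 hs (Nat.cast_lt.2 hm.1)

end RamseyTuran

section UpperBound

variable {s t k : ℕ}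

theorem exists_isNClique_subset_of_two_mul_indepNum_lt {V : Type*} [Fintype V] [Nonempty V]
    (ht : 2 ≤ t) {G : SimpleGraph V} {δ : ℝ}
    (hα : 2 * G.indepNum < δ * ramseyQ t (Fintype.card V)) {U : Finset V}
    (hU : δ * Fintype.card V ≤ #U) : ∃ T ⊆ U, G.IsNClique t T := by
  by_contra! hfree
  have hQ : (ramseyQ t (Fintype.card V) * #U : ℝ) ≤ 2 * Fintype.card V * G.indepNum := by
    exact_mod_cast ramseyQ_card_mul_card_le ht fun T hTU => hfree T (coe_subset.1 hTU)
  have hV : (0 : ℝ) < Fintype.card V := by exact_mod_cast Fintype.card_pos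
  refine (mul_lt_mul_of_pos_right hα hV).not_ge ?_
  calc δ * ramseyQ t (Fintype.card V) * Fintype.card V
      = ramseyQ t (Fintype.card V) * (δ * Fintype.card V) := by ring
    _ ≤ ramseyQ t (Fintype.card V) * #U := by gcongr
    _ ≤ 2 * G.indepNum * Fintype.card V := by linarith

theorem not_cliqueFree_card_mul_of_forall_piFinset {V ι : Type*} [Fintype ι] [DecidableEq ι]
    {G : SimpleGraph V} {t : ℕ} (ht : 1 ≤ t) {T : ι → Finset V} (hT : ∀ i, G.IsNClique t (T i))
    (hx : ∀ x ∈ Fintype.piFinset T, ⊤ ≤ G.comap x) :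
    ¬G.CliqueFree (Fintype.card ι * t) := by
  classical
  have hne (i : ι) : (T i).Nonempty := card_pos.1 ((hT i).card_eq ▸ ht)
  choose y hy using hne
  have hadj {i j : ι} (hij : i ≠ j) {u v : V} (hu : u ∈ T i) (hv : v ∈ T j) : G.Adj u v := by
    have hmem : Function.update (Function.update y i u) j v ∈ Fintype.piFinset T := by
      rw [Fintype.mem_piFinset]
      intro l
      rcases eq_or_ne l j with rfl | hlj
      · simpa
      · rcases eq_or_ne l i with rfl | hli <;> simp [*]
    simpa [hij] using hx _ hmem ((SimpleGraph.top_adj i j).2 hij)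
  intro hfree
  refine hfree (univ.biUnion T) ⟨fun u hu v hv huv => ?_, ?_⟩
  · obtain ⟨i, hi⟩ : ∃ i, u ∈ T i := by simpa using hu
    obtain ⟨j, hj⟩ : ∃ j, v ∈ T j := by simpa using hv
    rcases eq_or_ne i j with rfl | hij
    · exact (hT i).isClique hi hj huv
    · exact hadj hij hi hj
  · rw [card_biUnion fun i _ j _ hij =>
      disjoint_left.2 fun u hu hv => (hadj hij hu hv).ne rfl]
    simp [(hT _).card_eq]

theorem not_cliqueFree_of_two_rpow_le_homDensity_top {V : Type*} [Fintype V] [Nonempty V]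
    (ht : 2 ≤ t) {C x : ℝ} (hC : 1 ≤ C) (hx : 2 * t * C + 1 ≤ x)
    (hV : (Fintype.card V : ℝ) = 2 ^ (x ^ (k + 1))) {G : SimpleGraph V}
    (hα : G.indepNum < 2 ^ (-((2 * t * C + 2) * x ^ k)) * (ramseyQ t (Fintype.card V) : ℝ))
    (hG : 2 ^ (-C) ≤ homDensity (⊤ : SimpleGraph (Fin (k + 1))) G) :
    ¬G.CliqueFree ((k + 1) * t) := by
  have hxk : 1 ≤ x ^ k := one_le_pow₀ (by nlinarith [(Nat.cast_nonneg t : (0 : ℝ) ≤ t)])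
  have htwo : 2 * (2 : ℝ) ^ (-((2 * t * C + 2) * x ^ k)) ≤ 2 ^ (-((2 * t * C + 1) * x ^ k)) := by
    calc 2 * (2 : ℝ) ^ (-((2 * t * C + 2) * x ^ k))
        = 2 ^ (1 - (2 * t * C + 2) * x ^ k) := by
          rw [sub_eq_add_neg, Real.rpow_add two_pos, Real.rpow_one]
      _ ≤ 2 ^ (-((2 * t * C + 1) * x ^ k)) :=
          Real.rpow_le_rpow_of_exponent_le one_le_two (by linarith)
  have hα2 : 2 * G.indepNum <
      2 ^ (-((2 * t * C + 1) * x ^ k)) * (ramseyQ t (Fintype.card V) : ℝ) := by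
    calc 2 * (G.indepNum : ℝ)
        < 2 * (2 ^ (-((2 * t * C + 2) * x ^ k)) * ramseyQ t (Fintype.card V)) := by gcongr
      _ ≤ _ := by
        rw [← mul_assoc]
        gcongr
  obtain ⟨T, hT, hTG⟩ := exists_piFinset_of_two_rpow_le_proportion (P := G.IsNClique t)
    (by lia) hC hx hV (fun U hU => by
      obtain ⟨T, hTU, hT⟩ := exists_isNClique_subset_of_two_mul_indepNum_lt ht hα2 hU
      exact ⟨T, hTU, hT.card_eq, hT⟩) hG
  simpa using not_cliqueFree_card_mul_of_forall_piFinset (by lia) hT hTG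

theorem exists_ncard_edgeSet_le_of_indepNum_lt (ht : 2 ≤ t) (hk : 0 < k) {η : ℝ} (hη : 0 < η) :
    ∃ A : ℝ, ∀ (V : Type*) [Fintype V] (G : SimpleGraph V) (x : ℝ), A ≤ x →
      (Fintype.card V : ℝ) = 2 ^ (x ^ (k + 1)) → G.CliqueFree ((k + 1) * t) →
      G.indepNum < 2 ^ (-(A * x ^ k)) * (ramseyQ t (Fintype.card V) : ℝ) →
      G.edgeSet.ncard ≤ ((1 - 1 / k) / 2 + η) * (Fintype.card V : ℝ) ^ 2 := by
  obtain ⟨c, hc, hcG⟩ := exists_pos_le_homDensity_top hk (mul_pos two_pos hη)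
  set C : ℝ := max 1 (-Real.logb 2 c)
  have hCc : (2 : ℝ) ^ (-C) ≤ c := by
    rw [← Real.le_logb_iff_rpow_le one_lt_two hc]
    exact neg_le.1 (le_max_right _ _)
  refine ⟨2 * t * C + 2, fun V _ G x hx hV hfree hα => ?_⟩
  have : Nonempty V := Fintype.card_pos_iff.1 (by
    have : (0 : ℝ) < Fintype.card V := hV ▸ by positivity
    exact_mod_cast this)
  by_contra! hlt
  have hdense : 1 - 1 / k + 2 * η ≤ homDensity (⊤ : SimpleGraph (Fin 2)) G := by
    refine le_of_mul_le_mul_right ?_ (by positivity : (0 : ℝ) < (Fintype.card V : ℝ) ^ 2)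
    rw [homDensity_top_fin_two_mul_card_sq]
    linarith
  exact not_cliqueFree_of_two_rpow_le_homDensity_top ht (le_max_left 1 _) (by linarith) hV hα
    (hCc.trans (hcG V G hdense)) hfree

theorem tendsto_logb_natCast_rpow {a : ℝ} (ha : 0 < a) :
    Tendsto (fun n : ℕ => Real.logb 2 n ^ a) atTop atTop :=
  (tendsto_rpow_atTop ha).comp
    ((Real.tendsto_logb_atTop one_lt_two).comp tendsto_natCast_atTop_atTop)

theorem tendsto_phiEps {ω : ℕ → ℝ} (hω : Tendsto ω atTop atTop) {ε : ℝ} (hε : ε < 1) :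
    Tendsto (phiEps ω ε) atTop (𝓝 0) :=
  (tendsto_rpow_atBot_of_base_gt_one 2 one_lt_two).comp
    (tendsto_neg_atTop_atBot.comp (hω.atTop_mul_atTop₀ (tendsto_logb_natCast_rpow (sub_pos.2 hε))))

theorem phiEps_logb_rpow {δ ε : ℝ} (hδ : 0 ≤ δ) (hε : ε ≤ 1) :
    phiEps (fun n => Real.logb 2 n ^ δ) ε =
      fun n : ℕ => (2 : ℝ) ^ (-(Real.logb 2 n ^ (1 - (ε - δ)))) := by
  funext n
  have hlog : 0 ≤ Real.logb 2 (n : ℝ) := div_nonneg (Real.log_natCast_nonneg n) (by positivity)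
  rw [phiEps, ← Real.rpow_add_of_nonneg hlog hδ (sub_nonneg.2 hε)]
  ring_nf

theorem upperRTDensity_phiEps_mul_ramseyQ_le (ht : 2 ≤ t) (hk : 0 < k) (hs : s ≤ (k + 1) * t)
    {ω : ℕ → ℝ} (hω : Tendsto ω atTop atTop) :
    upperRTDensity (⊤ : SimpleGraph (Fin s))
      (fun n => phiEps ω (1 / (k + 1 : ℕ)) n * (ramseyQ t n : ℝ)) ≤ (1 - 1 / (k : ℝ)) / 2 := by
  refine le_of_forall_pos_le_add fun η hη => ?_
  obtain ⟨A, hA⟩ := exists_ncard_edgeSet_le_of_indepNum_lt ht hk hη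
  have hk1 := Nat.one_sub_one_div_cast_nonneg (α := ℝ) k
  refine upperRTDensity_le_of_eventually (by positivity) ?_
  filter_upwards [hω.eventually_ge_atTop A, eventually_gt_atTop 0,
    (tendsto_logb_natCast_rpow (a := 1 / (k + 1 : ℕ)) (by positivity)).eventually_ge_atTop A]
    with n hωn hn hx G hfree hα
  have hlog : 0 ≤ Real.logb 2 (n : ℝ) := div_nonneg (Real.log_natCast_nonneg n) (by positivity)
  have hxk : (Real.logb 2 n ^ (1 / (k + 1 : ℕ) : ℝ)) ^ k =
      Real.logb 2 n ^ (1 - 1 / (k + 1 : ℕ) : ℝ) := by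
    rw [← Real.rpow_mul_natCast hlog]
    congr 1
    push_cast
    field_simp
    ring
  have hn2 : (n : ℝ) = 2 ^ ((Real.logb 2 n ^ (1 / (k + 1 : ℕ) : ℝ)) ^ (k + 1)) := by
    rw [one_div, Real.rpow_inv_natCast_pow hlog k.succ_ne_zero,
      Real.rpow_logb two_pos (by norm_num) (by exact_mod_cast hn)]
  have hφ : phiEps ω (1 / (k + 1 : ℕ)) n ≤
      2 ^ (-(A * (Real.logb 2 n ^ (1 / (k + 1 : ℕ) : ℝ)) ^ k)) := by
    rw [hxk, phiEps]
    gcongr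
    exact one_le_two
  simpa using hA (Fin n) G _ hx (by simpa using hn2) (hfree.mono hs)
    (hα.trans_le (by simpa using mul_le_mul_of_nonneg_right hφ (Nat.cast_nonneg _)))

end UpperBound

theorem mainTheorem11_general (s t : ℕ) (ht : 2 ≤ t)
    (hpt : HasPhaseTransition (⊤ : SimpleGraph (Fin s))
      (fun n : ℕ => (ramseyQ t n : ℝ)) (fun n : ℕ => (ramseyQ (t + 1) n : ℝ))) :
    (∃ ε : ℝ, 0 < ε ∧ ε < 1 ∧ ∀ ω : ℕ → ℝ, Tendsto ω atTop atTop →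
      HasPhiPhaseTransition (⊤ : SimpleGraph (Fin s)) (phiEps ω ε)
        (fun n : ℕ => (ramseyQ t n : ℝ)) ∧
      ¬ HasPhaseTransition (⊤ : SimpleGraph (Fin s))
        (fun n : ℕ => phiEps ω ε n * (ramseyQ t n : ℝ))
        (fun n : ℕ => (ramseyQ (t + 1) n : ℝ))) ∧
    HasWeakPhaseTransition (⊤ : SimpleGraph (Fin s)) (fun n : ℕ => (ramseyQ t n : ℝ)) := by
  have hts : t < s := lt_of_hasPhaseTransition_ramseyQ hpt
  obtain ⟨k, hk, hks, hsk⟩ : ∃ k, 0 < k ∧ k * t < s ∧ s ≤ (k + 1) * t := by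
    refine ⟨(s - 1) / t, Nat.div_pos (by lia) (by lia), ?_, ?_⟩
    · exact (Nat.div_mul_le_self _ _).trans_lt (by lia)
    · exact Nat.le_of_pred_lt (Nat.lt_mul_of_div_lt (Nat.lt_succ_self _) (by lia))
  set ε : ℝ := 1 / (k + 1 : ℕ)
  have hε0 : 0 < ε := by positivity
  have hε1 : ε < 1 := (div_lt_one (by positivity)).2 (by exact_mod_cast Nat.succ_lt_succ hk)
  have hupper {ω : ℕ → ℝ} (hω : Tendsto ω atTop atTop) :=
    (upperRTDensity_phiEps_mul_ramseyQ_le ht hk hsk hω).trans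
      (one_sub_one_div_half_le_upperRTDensity_ramseyQ (t := t + 1) (by lia) hk hks)
  have hphi {ω : ℕ → ℝ} (hω : Tendsto ω atTop atTop) :
      HasPhiPhaseTransition (⊤ : SimpleGraph (Fin s)) (phiEps ω ε) fun n => (ramseyQ t n : ℝ) :=
    ⟨tendsto_phiEps hω hε1, (hupper hω).trans_lt hpt⟩
  refine ⟨⟨ε, hε0, hε1, fun ω hω =>
    ⟨hphi hω, (lowerRTDensity_le_upperRTDensity.trans (hupper hω)).not_gt⟩⟩,
    ε / 2, half_pos hε0, ?_⟩
  have hweak := hphi (tendsto_logb_natCast_rpow (half_pos hε0))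
  rwa [phiEps_logb_rpow (half_pos hε0).le hε1.le, sub_half] at hweak

theorem mainTheorem11 (s t : ℕ) (ht : 2 ≤ t)
    (hgap : RamseyGap (t + 1))
    (hpt : HasPhaseTransition (⊤ : SimpleGraph (Fin s))
      (fun n : ℕ => (ramseyQ t n : ℝ)) (fun n : ℕ => (ramseyQ (t + 1) n : ℝ))) :
    (∃ ε : ℝ, 0 < ε ∧ ε < 1 ∧ ∀ ω : ℕ → ℝ, Tendsto ω atTop atTop →
      HasPhiPhaseTransition (⊤ : SimpleGraph (Fin s)) (phiEps ω ε)
        (fun n : ℕ => (ramseyQ t n : ℝ)) ∧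
      ¬ HasPhaseTransition (⊤ : SimpleGraph (Fin s))
        (fun n : ℕ => phiEps ω ε n * (ramseyQ t n : ℝ))
        (fun n : ℕ => (ramseyQ (t + 1) n : ℝ))) ∧
    HasWeakPhaseTransition (⊤ : SimpleGraph (Fin s)) (fun n : ℕ => (ramseyQ t n : ℝ)) :=
  mainTheorem11_general s t ht hpt
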